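/- Let $\mathbb F$ be a field of characteristic different from $2$. If $\mathfrak g$ is a Lie algebra over $\mathbb F$ and $(\ ,\ )$ is a nondegenerate symmetric bilinear form on $\mathfrak g$, the pair $(\mathfrak g,(\ ,\ ))$ is called a pseudo-Riemannian Lie algebra if there is a bilinear product $(u,v)\mapsto uv$ on $\mathfrak g$ such that for all $u,v,w\in\mathfrak g$ $$uv-vu=[u,v],\qquad (uv,w)+(v,uw)=0,\qquad [uv,w]+[u,wv]=0 .$$ It is called a Riemann-Lie algebra if moreover $\mathbb F=\mathbb R$ and $(\ ,\ )$ is positive definite. For $c\in\mathbb F$, a basis $x,y,z$ of $\mathfrak g$ is called $c$-standard if $$[x,y]=z,\qquad [x,z]=cy,\qquad [y,z]=0 .$$ **Proposition.** Let $\mathfrak g$ be a $3$-dimensional Lie algebra over $\mathbb F$ with zero center. 1. Let $(\ ,\ )$ be a nondegenerate symmetric bilinear form on $\mathfrak g$. Then $(\mathfrak g,(\ ,\ ))$ is a pseudo-Riemannian Lie algebra if and only if there are nonzero $a,b,c\in\mathbb F$ and a $c$-standard basis $x,y,z$ of $\mathfrak g$ with $$(x,x)=a,\quad (y,y)=b,\quad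 (z,z)=-bc,\quad (x,y)=(x,z)=(y,z)=0. \tag{$*$}$$ 2. There is a form $(\ ,\ )$ for which $(\mathfrak g,(\ ,\ ))$ is a pseudo-Riemannian Lie algebra if and only if $\mathfrak g$ has a $c$-standard basis for some $c\neq 0$. Moreover, for every $c$-standard basis with $c\ne0$ and all nonzero $a,b\in\mathbb F$, there is exactly one symmetric bilinear form satisfying $(*)$, and $\mathfrak g$ with this form is a pseudo-Riemannian Lie algebra. 3. If $x,y,z$ is a $c$-standard basis with $c\neq0$ and the form satisfies $(*)$ with $a,b\ne 0$, then a bilinear product satisfies the three conditions above if and only if $xy=[x,y]$, $xz=[x,z]$, and all other products of two basis vectors are zero. Finally, let $\mathbb F=\mathbb R$, let $x,y,z$ be a $c$-standard basis of a real Lie algebra $\mathfrak g$ with $c<0$, and let the form be given by $(*)$ with $a>0$, $b>0$. Then $(\mathfrak g,(\ ,\ ))$ is a Riemann-Lie algebra, and it has an orthonormal basis $s,p,q$ and a real $t\ne0$ such that $[s,p]=tq$, $[s,q]=-tp$, $[p,q]=0$, and the product is $sp=[s,p]$, $sq=[s,q]$, all other products of basis vectors being zero. -/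

import Mathlib

universe u v

/-- `A`, written `A u v` for the product `uv`, satisfies the conditions
`uv - vu = [u,v]`, `(uv,w) + (v,uw) = 0` and `[uv,w] + [u,wv] = 0`
with respect to the bilinear form `B = ( , )`. -/
structure IsPRProduct {F : Type u} {g : Type v} [Field F] [LieRing g] [LieAlgebra F g]
    (B : LinearMap.BilinForm F g) (A : g →ₗ[F] g →ₗ[F] g) : Prop where
  pr1 : ∀ u v : g, A u v - A v u = ⁅u, v⁆
  pr2 : ∀ u v w : g, B (A u v) w + B v (A u w) = 0
  pr3 : ∀ u v w : g, ⁅A u v, w⁆ + ⁅u, A w v⁆ = 0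

/-- `(g, B)` is a pseudo-Riemannian Lie algebra. -/
structure IsPseudoRiemannianLie {F : Type u} {g : Type v} [Field F] [LieRing g] [LieAlgebra F g]
    (B : LinearMap.BilinForm F g) : Prop where
  symm : B.IsSymm
  nondegenerate : B.Nondegenerate
  exists_product : ∃ A : g →ₗ[F] g →ₗ[F] g, IsPRProduct B A

/-- `(g, B)` is a Riemann-Lie algebra: real pseudo-Riemannian with `B` positive definite. -/
structure IsRiemannLie {g : Type v} [LieRing g] [LieAlgebra ℝ g]
    (B : LinearMap.BilinForm ℝ g) : Prop extends IsPseudoRiemannianLie B where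
  pos : ∀ u : g, u ≠ 0 → 0 < B u u

/-- In the basis `x = e 0`, `y = e 1`, `z = e 2` one has
`[x,y] = z`, `[x,z] = c y`, `[y,z] = 0`. -/
def HasStandardBracket {F : Type u} {g : Type v} [Field F] [LieRing g] [LieAlgebra F g]
    (e : Module.Basis (Fin 3) F g) (c : F) : Prop :=
  ⁅e 0, e 1⁆ = e 2 ∧ ⁅e 0, e 2⁆ = c • e 1 ∧ ⁅e 1, e 2⁆ = 0

/-- The form `B` is diagonal in the basis `e`, with diagonal entries `d 0`, `d 1`, `d 2`. -/
def HasDiagonalForm {F : Type u} {g : Type v} [Field F] [LieRing g] [LieAlgebra F g]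
    (e : Module.Basis (Fin 3) F g) (d : Fin 3 → F) (B : LinearMap.BilinForm F g) : Prop :=
  ∀ i j : Fin 3, B (e i) (e j) = if i = j then d i else 0

/-- With `x = e 0`, `y = e 1`, `z = e 2`: `xy = [x,y]`, `xz = [x,z]`, and all other products
of basis vectors are zero. -/
def HasStandardProduct {F : Type u} {g : Type v} [Field F] [LieRing g] [LieAlgebra F g]
    (e : Module.Basis (Fin 3) F g) (A : g →ₗ[F] g →ₗ[F] g) : Prop :=
  A (e 0) (e 1) = ⁅e 0, e 1⁆ ∧ A (e 0) (e 2) = ⁅e 0, e 2⁆ ∧ A (e 0) (e 0) = 0 ∧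
    (∀ j : Fin 3, A (e 1) (e j) = 0) ∧ (∀ j : Fin 3, A (e 2) (e j) = 0)

/-! ### Coordinates, uniqueness of the product, and the model -/

section Basic

variable {F : Type u} {g : Type v} [Field F]

/-! Torsion-freeness and skewness determine the product, as for a Levi-Civita connection
(`IsPRProduct.unique`), so in the normal form it suffices to check that `standardProduct` works.

For the converse, fix `v` and let `R u = uv`. The third condition says `[Ru,w] + [u,Rw] = 0`, so the
bracket Λ²g → g kills the image of the map induced by `R` on Λ²g. Were the bracket injective, every
`R` would vanish, and with it the bracket. So it has a kernel; bivectors in dimension 3 are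
decomposable, which yields independent commuting `y`, `z` (`exists_commuting`). Zero center makes
`ad x` injective on their span `P`, and then left multiplication by `P` is zero while `xg ⊆ P`
(`IsPRProduct.left_mul`). Thus `x` acts on `P` as `ad x`, invertibly and skewly. Correcting `x` by
an element of `P` gives `xx = 0`, hence `x ⊥ P`. A nonisotropic `y` in `P` and `z = xy` then give
the normal form. -/

theorem exists_coords [AddCommGroup g] [Module F g] (e : Module.Basis (Fin 3) F g) (u : g) :
    ∃ a b c : F, u = a • e 0 + b • e 1 + c • e 2 :=
  ⟨e.repr u 0, e.repr u 1, e.repr u 2, by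
    conv_lhs => rw [← e.sum_repr u, Fin.sum_univ_three]⟩

theorem coords_eq_zero [AddCommGroup g] [Module F g] (e : Module.Basis (Fin 3) F g) {a b c : F}
    (h : a • e 0 + b • e 1 + c • e 2 = 0) : a = 0 ∧ b = 0 ∧ c = 0 := by
  have := Fintype.linearIndependent_iff.1 e.linearIndependent ![a, b, c]
    (by simpa [Fin.sum_univ_three] using h)
  exact ⟨this 0, this 1, this 2⟩

theorem exists_basis_of_coords [AddCommGroup g] [Module F g] (hd : Module.finrank F g = 3)
    (x y z : g)
    (h : ∀ a b c : F, a • x + b • y + c • z = 0 → a = 0 ∧ b = 0 ∧ c = 0) :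
    ∃ e : Module.Basis (Fin 3) F g, e 0 = x ∧ e 1 = y ∧ e 2 = z := by
  have li : LinearIndependent F ![x, y, z] := by
    refine Fintype.linearIndependent_iff.2 fun k hk => ?_
    obtain ⟨h0, h1, h2⟩ := h (k 0) (k 1) (k 2) (by simpa [Fin.sum_univ_three] using hk)
    intro i
    fin_cases i
    exacts [h0, h1, h2]
  refine ⟨basisOfLinearIndependentOfCardEqFinrank li (by simp [hd]), ?_⟩
  simp

variable [LieRing g] [LieAlgebra F g]

theorem HasDiagonalForm.isSymm {e : Module.Basis (Fin 3) F g} {d : Fin 3 → F}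
    {B : LinearMap.BilinForm F g} (h : HasDiagonalForm e d B) : B.IsSymm := by
  have : B = LinearMap.flip B := LinearMap.ext_basis e e fun i j => by
    rw [LinearMap.flip_apply, h, h]
    by_cases hij : i = j
    · subst hij; rfl
    · rw [if_neg hij, if_neg (Ne.symm hij)]
  exact ⟨fun x y => by conv_lhs => rw [this, LinearMap.flip_apply]⟩

theorem HasDiagonalForm.apply {e : Module.Basis (Fin 3) F g} {d : Fin 3 → F}
    {B : LinearMap.BilinForm F g} (h : HasDiagonalForm e d B) (a b c a' b' c' : F) :
    B (a • e 0 + b • e 1 + c • e 2) (a' • e 0 + b' • e 1 + c' • e 2) =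
      d 0 * a * a' + d 1 * b * b' + d 2 * c * c' := by
  have h' := fun i j => h i j
  simp [h']
  ring

theorem HasDiagonalForm.nondegenerate {e : Module.Basis (Fin 3) F g} {d : Fin 3 → F}
    {B : LinearMap.BilinForm F g} (h : HasDiagonalForm e d B) (hd : ∀ i, d i ≠ 0) :
    B.Nondegenerate := by
  have key : ∀ u, (∀ v, B u v = 0) → u = 0 := by
    intro u hu
    obtain ⟨a, b, c, rfl⟩ := exists_coords e u
    have h0 := hu ((1 : F) • e 0 + (0 : F) • e 1 + (0 : F) • e 2)
    have h1 := hu ((0 : F) • e 0 + (1 : F) • e 1 + (0 : F) • e 2)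
    have h2 := hu ((0 : F) • e 0 + (0 : F) • e 1 + (1 : F) • e 2)
    rw [h.apply] at h0 h1 h2
    have ha : a = 0 := by simpa [hd] using h0
    have hb : b = 0 := by simpa [hd] using h1
    have hc : c = 0 := by simpa [hd] using h2
    simp [ha, hb, hc]
  exact ⟨key, fun u hu => key u fun v => by rw [h.isSymm.eq]; exact hu v⟩

theorem existsUnique_hasDiagonalForm (e : Module.Basis (Fin 3) F g) (d : Fin 3 → F) :
    ∃! B : LinearMap.BilinForm F g, HasDiagonalForm e d B := by
  refine ⟨e.constr F fun i => d i • e.coord i, fun i j => ?_, fun B hB => ?_⟩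
  · simp [Finsupp.single_apply, eq_comm]
  · refine LinearMap.ext_basis e e fun i j => ?_
    rw [hB]
    simp [Finsupp.single_apply, eq_comm]

/-- A product with `uv - vu = [u,v]` that is skew for a nondegenerate symmetric form is unique. -/
theorem IsPRProduct.unique (h2 : (2 : F) ≠ 0) {B : LinearMap.BilinForm F g} (hs : B.IsSymm)
    (hn : B.Nondegenerate) {A A' : g →ₗ[F] g →ₗ[F] g} (h : IsPRProduct B A)
    (h' : IsPRProduct B A') : A = A' := by
  have comm : ∀ u v w, B (A u v - A' u v) w = B (A v u - A' v u) w := fun u v w => by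
    congr 2
    have := (h.pr1 u v).trans (h'.pr1 u v).symm
    rw [sub_eq_sub_iff_add_eq_add] at this ⊢
    rw [this, add_comm]
  have skew : ∀ u v w, B (A u v - A' u v) w = -B (A u w - A' u w) v := fun u v w => by
    have e1 := h.pr2 u v w
    have e2 := h'.pr2 u v w
    rw [hs.eq] at e1 e2
    rw [hs.eq v] at e1 e2
    rw [hs.eq w] at e1 e2
    simp only [map_sub, LinearMap.sub_apply]
    linear_combination e1 - e2
  refine LinearMap.ext₂ fun u v => sub_eq_zero.1 (hn.1 _ fun w => ?_)
  -- A trilinear form symmetric in its first two slots and skew in its last two vanishes: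
  -- alternating the swaps returns to the start after three sign changes.
  have e : B (A u v - A' u v) w = -B (A u v - A' u v) w := by
    conv_lhs => rw [skew, comm, skew, comm, skew, comm]
    ring
  have : 2 * B (A u v - A' u v) w = 0 := by linear_combination e
  exact (mul_eq_zero.1 this).resolve_left h2

/-- The product `uv = u₀ [x,v]`, where `u₀` is the `x`-coordinate of `u`. -/
noncomputable def standardProduct (e : Module.Basis (Fin 3) F g) : g →ₗ[F] g →ₗ[F] g :=
  (e.coord 0).smulRight (LieAlgebra.ad F g (e 0) : g →ₗ[F] g)

theorem standardProduct_apply (e : Module.Basis (Fin 3) F g) (a b c : F) (v : g) :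
    standardProduct e (a • e 0 + b • e 1 + c • e 2) v = a • ⁅e 0, v⁆ := by
  simp [standardProduct]

theorem hasStandardProduct_standardProduct (e : Module.Basis (Fin 3) F g) :
    HasStandardProduct e (standardProduct e) := by
  simp [HasStandardProduct, standardProduct]

theorem HasStandardProduct.unique {e : Module.Basis (Fin 3) F g} {A A' : g →ₗ[F] g →ₗ[F] g}
    (h : HasStandardProduct e A) (h' : HasStandardProduct e A') : A = A' := by
  obtain ⟨h1, h2, h3, h4, h5⟩ := h
  obtain ⟨h1', h2', h3', h4', h5'⟩ := h'
  refine LinearMap.ext_basis e e fun i j => ?_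
  fin_cases i
  · fin_cases j
    exacts [h3.trans h3'.symm, h1.trans h1'.symm, h2.trans h2'.symm]
  · exact (h4 j).trans (h4' j).symm
  · exact (h5 j).trans (h5' j).symm

theorem HasStandardBracket.lie {e : Module.Basis (Fin 3) F g} {c : F}
    (h : HasStandardBracket e c) (a₀ a₁ a₂ b₀ b₁ b₂ : F) :
    ⁅a₀ • e 0 + a₁ • e 1 + a₂ • e 2, b₀ • e 0 + b₁ • e 1 + b₂ • e 2⁆ =
      (0 : F) • e 0 + (c * (a₀ * b₂ - a₂ * b₀)) • e 1 + (a₀ * b₁ - a₁ * b₀) • e 2 := by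
  obtain ⟨h1, h2, h3⟩ := h
  have h1' : ⁅e 1, e 0⁆ = -e 2 := by rw [← lie_skew, h1]
  have h2' : ⁅e 2, e 0⁆ = -(c • e 1) := by rw [← lie_skew, h2]
  have h3' : ⁅e 2, e 1⁆ = 0 := by rw [← lie_skew, h3, neg_zero]
  simp only [lie_add, add_lie, lie_smul, smul_lie, h1, h2, h3, h1', h2', h3', lie_self]
  module

theorem HasStandardBracket.standardProduct_apply {e : Module.Basis (Fin 3) F g} {c : F}
    (h : HasStandardBracket e c) (a₀ a₁ a₂ b₀ b₁ b₂ : F) :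
    standardProduct e (a₀ • e 0 + a₁ • e 1 + a₂ • e 2) (b₀ • e 0 + b₁ • e 1 + b₂ • e 2) =
      (0 : F) • e 0 + (c * (a₀ * b₂)) • e 1 + (a₀ * b₁) • e 2 := by
  have := h.lie a₀ 0 0 b₀ b₁ b₂
  rw [_root_.standardProduct_apply, ← smul_lie]
  simpa using this

/-- The entry `-(b * c)` is exactly what makes `ad x` skew. The third condition holds because every
`[x,v]` lies in the abelian span of `y` and `z`. -/
theorem isPRProduct_standardProduct {e : Module.Basis (Fin 3) F g} {a b c : F}
    {B : LinearMap.BilinForm F g} (h : HasStandardBracket e c)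
    (hB : HasDiagonalForm e ![a, b, -(b * c)] B) : IsPRProduct B (standardProduct e) := by
  refine ⟨fun u v => ?_, fun u v w => ?_, fun u v w => ?_⟩ <;>
    obtain ⟨u₀, u₁, u₂, rfl⟩ := exists_coords e u <;>
    obtain ⟨v₀, v₁, v₂, rfl⟩ := exists_coords e v
  · rw [h.standardProduct_apply, h.standardProduct_apply, h.lie]
    module
  · obtain ⟨w₀, w₁, w₂, rfl⟩ := exists_coords e w
    rw [h.standardProduct_apply, h.standardProduct_apply, hB.apply, hB.apply]
    simp
    ring
  · obtain ⟨w₀, w₁, w₂, rfl⟩ := exists_coords e w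
    rw [h.standardProduct_apply, h.standardProduct_apply, h.lie, h.lie]
    module

theorem HasStandardBracket.isPseudoRiemannianLie {e : Module.Basis (Fin 3) F g} {a b c : F}
    {B : LinearMap.BilinForm F g} (ha : a ≠ 0) (hb : b ≠ 0) (hc : c ≠ 0)
    (h : HasStandardBracket e c) (hB : HasDiagonalForm e ![a, b, -(b * c)] B) :
    IsPseudoRiemannianLie B where
  symm := hB.isSymm
  nondegenerate := hB.nondegenerate fun i => by fin_cases i <;> simp [ha, hb, hc]
  exists_product := ⟨_, isPRProduct_standardProduct h hB⟩

theorem HasStandardBracket.isPRProduct_iff (h2 : (2 : F) ≠ 0) {e : Module.Basis (Fin 3) F g}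
    {a b c : F} {B : LinearMap.BilinForm F g} (ha : a ≠ 0) (hb : b ≠ 0) (hc : c ≠ 0)
    (h : HasStandardBracket e c) (hB : HasDiagonalForm e ![a, b, -(b * c)] B)
    (A : g →ₗ[F] g →ₗ[F] g) : IsPRProduct B A ↔ HasStandardProduct e A := by
  constructor
  · intro hA
    have hP := h.isPseudoRiemannianLie ha hb hc hB
    rw [hA.unique h2 hP.symm hP.nondegenerate (isPRProduct_standardProduct h hB)]
    exact hasStandardProduct_standardProduct e
  · intro hA
    rw [hA.unique (hasStandardProduct_standardProduct e)]
    exact isPRProduct_standardProduct h hB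

end Basic

/-! ### The real case -/

theorem HasStandardBracket.isRiemannLie {g : Type v} [LieRing g] [LieAlgebra ℝ g]
    {e : Module.Basis (Fin 3) ℝ g} {a b c : ℝ} {B : LinearMap.BilinForm ℝ g}
    (h : HasStandardBracket e c) (hc : c < 0) (ha : 0 < a) (hb : 0 < b)
    (hB : HasDiagonalForm e ![a, b, -(b * c)] B) : IsRiemannLie B where
  toIsPseudoRiemannianLie := h.isPseudoRiemannianLie ha.ne' hb.ne' hc.ne hB
  pos u hu := by
    obtain ⟨p, q, r, rfl⟩ := exists_coords e u
    rw [hB.apply]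
    have hd : 0 < -(b * c) := by nlinarith
    by_contra! hle
    have hp : 0 ≤ a * p * p := by rw [mul_assoc]; exact mul_nonneg ha.le (mul_self_nonneg p)
    have hq : 0 ≤ b * q * q := by rw [mul_assoc]; exact mul_nonneg hb.le (mul_self_nonneg q)
    have hr : 0 ≤ -(b * c) * r * r := by
      rw [mul_assoc]; exact mul_nonneg hd.le (mul_self_nonneg r)
    simp only [Matrix.cons_val_zero, Matrix.cons_val_one, Matrix.cons_val] at hle
    have hp0 : a * p * p = 0 := by linarith
    have hq0 : b * q * q = 0 := by linarith
    have hr0 : -(b * c) * r * r = 0 := by linarith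
    have hp1 : p = 0 := by simpa [ha.ne'] using hp0
    have hq1 : q = 0 := by simpa [hb.ne'] using hq0
    have hr1 : r = 0 := by simpa [hb.ne', hc.ne] using hr0
    simp [hp1, hq1, hr1] at hu

theorem HasStandardBracket.exists_orthonormal {g : Type v} [LieRing g] [LieAlgebra ℝ g]
    {e : Module.Basis (Fin 3) ℝ g} {a b c : ℝ} {B : LinearMap.BilinForm ℝ g}
    (h : HasStandardBracket e c) (hc : c < 0) (ha : 0 < a) (hb : 0 < b)
    (hB : HasDiagonalForm e ![a, b, -(b * c)] B) :
    ∃ (f : Module.Basis (Fin 3) ℝ g) (t : ℝ), t ≠ 0 ∧ HasDiagonalForm f ![1, 1, 1] B ∧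
      ⁅f 0, f 1⁆ = t • f 2 ∧ ⁅f 0, f 2⁆ = -(t • f 1) ∧ ⁅f 1, f 2⁆ = 0 ∧
      ∀ A : g →ₗ[ℝ] g →ₗ[ℝ] g, IsPRProduct B A → HasStandardProduct f A := by
  obtain ⟨α, hα, rfl⟩ : ∃ α : ℝ, 0 < α ∧ α ^ 2 = a := ⟨√a, Real.sqrt_pos.2 ha, Real.sq_sqrt ha.le⟩
  obtain ⟨β, hβ, rfl⟩ : ∃ β : ℝ, 0 < β ∧ β ^ 2 = b := ⟨√b, Real.sqrt_pos.2 hb, Real.sq_sqrt hb.le⟩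
  obtain ⟨γ, hγ, hγc⟩ : ∃ γ : ℝ, 0 < γ ∧ γ ^ 2 = -c :=
    ⟨√(-c), Real.sqrt_pos.2 (by linarith), Real.sq_sqrt (by linarith)⟩
  obtain rfl : c = -γ ^ 2 := by linarith
  have hα0 := hα.ne'
  have hβ0 := hβ.ne'
  have hγ0 := hγ.ne'
  obtain ⟨f, f0, f1, f2⟩ := exists_basis_of_coords (F := ℝ)
    (by simp [Module.finrank_eq_card_basis e]) (α⁻¹ • e 0) (β⁻¹ • e 1) ((β * γ)⁻¹ • e 2)
    (fun p q r hz => by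
      simp only [smul_smul] at hz
      simpa [hα0, hβ0, hγ0] using coords_eq_zero e hz)
  -- Normalizing `x`, `y`, `z` by their lengths `α`, `β`, `βγ` turns `[x,y] = z` into `[s,p] = (γ/α)
  -- q`.
  refine ⟨f, γ / α, by positivity, fun i j => ?_, ?_, ?_, ?_, fun A hA => ?_⟩
  · have hB' := fun i j => hB i j
    fin_cases i <;> fin_cases j <;> simp [f0, f1, f2, hB'] <;> field_simp
  · rw [f0, f1, f2, smul_lie, lie_smul, h.1]
    match_scalars
    field_simp
  · rw [f0, f1, f2, smul_lie, lie_smul, h.2.1, ← neg_smul]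
    match_scalars
    field_simp
  · rw [f1, f2, smul_lie, lie_smul, h.2.2, smul_zero, smul_zero]
  · obtain ⟨h1, h2, h3, h4, h5⟩ := (h.isPRProduct_iff two_ne_zero ha.ne' hb.ne' hc.ne hB A).1 hA
    refine ⟨?_, ?_, ?_, fun j => ?_, fun j => ?_⟩
    · simp [f0, f1, h1]
    · simp [f0, f2, h2]
    · simp [f0, h3]
    · fin_cases j <;> simp [f0, f1, f2, h4]
    · fin_cases j <;> simp [f0, f1, f2, h5]

/-! ### A commuting pair and left multiplications -/

section NormalForm

variable {F : Type u} {g : Type v} [Field F] [LieRing g] [LieAlgebra F g]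

/-- If the brackets of the vectors of a basis are independent, condition `[uv,w] + [u,wv] = 0`
forces the product to vanish. -/
theorem eq_zero_of_lie_independent (h2 : (2 : F) ≠ 0) (e : Module.Basis (Fin 3) F g)
    (hi : ∀ p q r : F, p • ⁅e 1, e 2⁆ + q • ⁅e 2, e 0⁆ + r • ⁅e 0, e 1⁆ = 0 →
      p = 0 ∧ q = 0 ∧ r = 0)
    (A : g →ₗ[F] g →ₗ[F] g) (h3 : ∀ u v w : g, ⁅A u v, w⁆ + ⁅u, A w v⁆ = 0) : A = 0 := by
  refine LinearMap.ext fun u => LinearMap.ext fun v => ?_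
  obtain ⟨a₀, a₁, a₂, h0⟩ := exists_coords e (A (e 0) v)
  obtain ⟨b₀, b₁, b₂, h1⟩ := exists_coords e (A (e 1) v)
  obtain ⟨c₀, c₁, c₂, h2'⟩ := exists_coords e (A (e 2) v)
  have s1 : ⁅e 1, e 0⁆ = -⁅e 0, e 1⁆ := (lie_skew _ _).symm
  have s2 : ⁅e 2, e 1⁆ = -⁅e 1, e 2⁆ := (lie_skew _ _).symm
  have s3 : ⁅e 0, e 2⁆ = -⁅e 2, e 0⁆ := (lie_skew _ _).symm
  have e01 := h3 (e 0) v (e 1)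
  have e12 := h3 (e 1) v (e 2)
  have e20 := h3 (e 2) v (e 0)
  rw [h0, h1] at e01
  rw [h1, h2'] at e12
  rw [h2', h0] at e20
  simp only [lie_add, add_lie, lie_smul, smul_lie, lie_self, s1, s2, s3] at e01 e12 e20
  obtain ⟨x1, x2, x3⟩ := hi (-a₂) (-b₂) (a₀ + b₁) (by rw [← e01]; module)
  obtain ⟨y1, y2, y3⟩ := hi (b₁ + c₂) (-b₀) (-c₀) (by rw [← e12]; module)
  obtain ⟨z1, z2, z3⟩ := hi (-a₁) (c₂ + a₀) (-c₁) (by rw [← e20]; module)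
  have ha : a₀ = 0 := by
    -- The three pairwise sums of the diagonal entries `a₀`, `b₁`, `c₂` of `R` vanish.
    have : 2 * a₀ = 0 := by linear_combination x3 + z2 - y1
    exact (mul_eq_zero.1 this).resolve_left h2
  have hb : b₁ = 0 := by linear_combination x3 - ha
  have hc : c₂ = 0 := by linear_combination z2 - ha
  rw [neg_eq_zero] at x1 x2 y2 y3 z1 z3
  obtain ⟨u₀, u₁, u₂, rfl⟩ := exists_coords e u
  simp [*]

/-- With `p` as pivot, `p` times the relation factors as the single bracket `[p y - q x, p z - r
x]`. -/
theorem exists_commuting_of_relation (hd : Module.finrank F g = 3) (e : Module.Basis (Fin 3) F g)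
    {p q r : F} (hp : p ≠ 0) (h : p • ⁅e 1, e 2⁆ + q • ⁅e 2, e 0⁆ + r • ⁅e 0, e 1⁆ = 0) :
    ∃ f : Module.Basis (Fin 3) F g, ⁅f 1, f 2⁆ = 0 := by
  obtain ⟨f, -, f1, f2⟩ := exists_basis_of_coords hd (e 0) (p • e 1 - q • e 0) (p • e 2 - r • e 0)
    (fun a b c hz => by
      have hz' : (a - b * q - c * r) • e 0 + (b * p) • e 1 + (c * p) • e 2 = 0 := by
        rw [← hz]; module
      obtain ⟨k0, k1, k2⟩ := coords_eq_zero e hz'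
      have hb := (mul_eq_zero.1 k1).resolve_right hp
      have hc := (mul_eq_zero.1 k2).resolve_right hp
      refine ⟨?_, hb, hc⟩
      simpa [hb, hc] using k0)
  refine ⟨f, ?_⟩
  have s1 : ⁅e 1, e 0⁆ = -⁅e 0, e 1⁆ := (lie_skew _ _).symm
  have s3 : ⁅e 0, e 2⁆ = -⁅e 2, e 0⁆ := (lie_skew _ _).symm
  rw [f1, f2]
  simp only [lie_sub, sub_lie, lie_smul, smul_lie, lie_self, s1, s3]
  have h' : p • (p • ⁅e 1, e 2⁆ + q • ⁅e 2, e 0⁆ + r • ⁅e 0, e 1⁆) = 0 := by rw [h, smul_zero]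
  refine Eq.trans ?_ h'
  module

theorem exists_commuting (h2 : (2 : F) ≠ 0) (hd : Module.finrank F g = 3)
    {A : g →ₗ[F] g →ₗ[F] g}
    (h1 : ∀ u v : g, A u v - A v u = ⁅u, v⁆) (h3 : ∀ u v w : g, ⁅A u v, w⁆ + ⁅u, A w v⁆ = 0) :
    ∃ f : Module.Basis (Fin 3) F g, ⁅f 1, f 2⁆ = 0 := by
  have : FiniteDimensional F g := FiniteDimensional.of_finrank_pos (by omega)
  let e : Module.Basis (Fin 3) F g := Module.finBasisOfFinrankEq F g hd
  by_contra hno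
  have hA : A = 0 := by
    refine eq_zero_of_lie_independent h2 e (fun p q r h => ?_) A h3
    -- Cyclic rotation preserves the shape of the relation, so any of its coefficients can serve as
    -- pivot.
    have rot : ∀ x y z : g, (∀ a b c : F, a • x + b • y + c • z = 0 → a = 0 ∧ b = 0 ∧ c = 0) →
        ∀ p q r : F, p • ⁅y, z⁆ + q • ⁅z, x⁆ + r • ⁅x, y⁆ = 0 → p = 0 := by
      intro x y z hi p q r h
      obtain ⟨f, rfl, rfl, rfl⟩ := exists_basis_of_coords hd x y z hi
      by_contra hp
      exact hno (exists_commuting_of_relation hd f hp h)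
    refine ⟨rot (e 0) (e 1) (e 2) (fun a b c hz => coords_eq_zero e hz) p q r h,
      rot (e 1) (e 2) (e 0) (fun a b c hz => ?_) q r p (by rw [← h]; abel),
      rot (e 2) (e 0) (e 1) (fun a b c hz => ?_) r p q (by rw [← h]; abel)⟩
    · obtain ⟨k0, k1, k2⟩ := coords_eq_zero e (a := c) (b := a) (c := b) (by rw [← hz]; abel)
      exact ⟨k1, k2, k0⟩
    · obtain ⟨k0, k1, k2⟩ := coords_eq_zero e (a := b) (b := c) (c := a) (by rw [← hz]; abel)
      exact ⟨k2, k0, k1⟩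
  exact hno ⟨e, by rw [← h1, hA]; simp⟩

/-- A combination of `y` and `z` commutes with both, so it is central once `ad x` kills it. -/
theorem lie_independent_of_center_eq_bot (hc : LieAlgebra.center F g = ⊥)
    (e : Module.Basis (Fin 3) F g) (h : ⁅e 1, e 2⁆ = 0) {s t : F}
    (hst : s • ⁅e 0, e 1⁆ + t • ⁅e 0, e 2⁆ = 0) : s = 0 ∧ t = 0 := by
  have hmem : s • e 1 + t • e 2 ∈ LieAlgebra.center F g := by
    rw [LieAlgebra.center, LieModule.mem_maxTrivSubmodule]
    intro u
    obtain ⟨a, b, c, rfl⟩ := exists_coords e u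
    have s2 : ⁅e 2, e 1⁆ = 0 := by rw [← lie_skew, h, neg_zero]
    simp only [lie_add, add_lie, lie_smul, smul_lie, lie_self, h, s2]
    have h' : a • (s • ⁅e 0, e 1⁆ + t • ⁅e 0, e 2⁆) = 0 := by rw [hst, smul_zero]
    refine Eq.trans ?_ h'
    module
  rw [hc, LieSubmodule.mem_bot] at hmem
  exact (coords_eq_zero e (a := 0) (by rw [zero_smul, zero_add]; exact hmem)).2

/-- In a basis `x, y, z` with `[y,z] = 0` and `[x,y]`, `[x,z]` independent, left multiplication
by `y` and by `z` vanishes, and `x v` lies in the span of `y` and `z`. -/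
theorem IsPRProduct.left_mul (h2 : (2 : F) ≠ 0) {B : LinearMap.BilinForm F g} (hs : B.IsSymm)
    (hn : B.Nondegenerate)
    {A : g →ₗ[F] g →ₗ[F] g} (h : IsPRProduct B A) (e : Module.Basis (Fin 3) F g)
    (h12 : ⁅e 1, e 2⁆ = 0)
    (hi : ∀ s t : F, s • ⁅e 0, e 1⁆ + t • ⁅e 0, e 2⁆ = 0 → s = 0 ∧ t = 0) :
    A (e 1) = 0 ∧ A (e 2) = 0 ∧ ∀ v, ∃ p q : F, A (e 0) v = p • e 1 + q • e 2 := by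
  have s1 : ⁅e 1, e 0⁆ = -⁅e 0, e 1⁆ := (lie_skew _ _).symm
  have s2 : ⁅e 2, e 1⁆ = 0 := by rw [← lie_skew, h12, neg_zero]
  have s3 : ⁅e 2, e 0⁆ = -⁅e 0, e 2⁆ := (lie_skew _ _).symm
  have key : ∀ v, ∃ r p q : F, A (e 0) v = r • e 0 + p • e 1 + q • e 2 ∧
      A (e 1) v = -r • e 1 ∧ A (e 2) v = -r • e 2 := by
    intro v
    obtain ⟨a₀, a₁, a₂, h0⟩ := exists_coords e (A (e 0) v)
    obtain ⟨b₀, b₁, b₂, h1⟩ := exists_coords e (A (e 1) v)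
    obtain ⟨c₀, c₁, c₂, h2⟩ := exists_coords e (A (e 2) v)
    have e01 := h.pr3 (e 0) v (e 1)
    have e02 := h.pr3 (e 0) v (e 2)
    have e12 := h.pr3 (e 1) v (e 2)
    rw [h0, h1] at e01
    rw [h0, h2] at e02
    rw [h1, h2] at e12
    simp only [lie_add, add_lie, lie_smul, smul_lie, lie_self, h12, s1, s2] at e01 e02 e12
    obtain ⟨x1, x2⟩ := hi (a₀ + b₁) b₂ (by rw [← e01]; module)
    obtain ⟨y1, y2⟩ := hi c₁ (a₀ + c₂) (by rw [← e02]; module)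
    obtain ⟨z1, z2⟩ := hi (-c₀) b₀ (by rw [← e12]; module)
    refine ⟨a₀, a₁, a₂, h0, ?_, ?_⟩
    · rw [h1, z2, x2, eq_neg_of_add_eq_zero_right x1]; simp
    · rw [h2, neg_eq_zero.1 z1, y1, eq_neg_of_add_eq_zero_right y2]; simp
  obtain ⟨r, p, q, k0, k1, k2⟩ := key (e 0)
  obtain ⟨r₁, p₁, q₁, k0₁, k1₁, k2₁⟩ := key (e 1)
  obtain ⟨r₂, p₂, q₂, k0₂, k1₂, k2₂⟩ := key (e 2)
  have e12 := h.pr1 (e 1) (e 2)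
  rw [k1₂, k2₁, h12] at e12
  obtain ⟨-, hr₂, hr₁⟩ := coords_eq_zero e (a := 0) (b := -r₂) (c := r₁) (by rw [← e12]; module)
  rw [neg_eq_zero] at hr₂
  subst hr₁ hr₂
  -- Otherwise `yx = -ry` and `yy = yz = 0`, and skewness of left multiplication by `y` makes `y`
  -- orthogonal to everything.
  have hr : r = 0 := by
    by_contra hr
    refine e.ne_zero 1 (hn.1 _ fun w => ?_)
    have t0 := h.pr2 (e 1) (e 0) (e 0)
    have t1 := h.pr2 (e 1) (e 0) (e 1)
    have t2 := h.pr2 (e 1) (e 0) (e 2)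
    rw [hs.eq (e 0), k1] at t0
    rw [k1, k1₁] at t1
    rw [k1, k1₂] at t2
    simp only [map_smul, LinearMap.smul_apply, smul_eq_mul, neg_zero, zero_smul, map_zero,
      add_zero, neg_mul, neg_eq_zero, mul_eq_zero, hr, false_or] at t0 t1 t2
    have t0' : B (e 1) (e 0) = 0 := by
      have : 2 * r * B (e 1) (e 0) = 0 := by linear_combination -t0
      exact (mul_eq_zero.1 this).resolve_left (mul_ne_zero h2 hr)
    obtain ⟨a, b, c, rfl⟩ := exists_coords e w
    simp [t0', t1, t2]
  subst hr
  simp only [neg_zero, zero_smul, zero_add] at k0 k1 k2 k0₁ k1₁ k2₁ k0₂ k1₂ k2₂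
  refine ⟨e.ext fun i => ?_, e.ext fun i => ?_, fun v => ?_⟩
  · fin_cases i
    exacts [k1, k1₁, k1₂]
  · fin_cases i
    exacts [k2, k2₁, k2₂]
  · obtain ⟨a, b, c, rfl⟩ := exists_coords e v
    exact ⟨a * p + b * p₁ + c * p₂, a * q + b * q₁ + c * q₂, by
      simp only [map_add, map_smul, k0, k0₁, k0₂]; module⟩

end NormalForm

/-! ### Reduction to the normal form -/

section Classification

variable {F : Type u} {g : Type v} [Field F] [LieRing g] [LieAlgebra F g]

/-- The first basis vector can be corrected so that its square vanishes. -/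
theorem IsPRProduct.exists_basis_square_zero (h2 : (2 : F) ≠ 0) (hd : Module.finrank F g = 3)
    (hc : LieAlgebra.center F g = ⊥) {B : LinearMap.BilinForm F g} (hs : B.IsSymm)
    (hn : B.Nondegenerate) {A : g →ₗ[F] g →ₗ[F] g} (h : IsPRProduct B A) :
    ∃ e : Module.Basis (Fin 3) F g, ⁅e 1, e 2⁆ = 0 ∧ A (e 0) (e 0) = 0 ∧
      B (e 0) (e 1) = 0 ∧ B (e 0) (e 2) = 0 := by
  obtain ⟨e, h12⟩ := exists_commuting h2 hd h.pr1 h.pr3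
  have hi := fun s t => lie_independent_of_center_eq_bot hc e h12 (s := s) (t := t)
  obtain ⟨l1, l2, hP⟩ := h.left_mul h2 hs hn e h12 hi
  obtain ⟨p₀, q₀, k0⟩ := hP (e 0)
  obtain ⟨p₁, q₁, k1⟩ := hP (e 1)
  obtain ⟨p₂, q₂, k2⟩ := hP (e 2)
  have b1 : ⁅e 0, e 1⁆ = p₁ • e 1 + q₁ • e 2 := by rw [← h.pr1, l1, k1]; simp
  have b2 : ⁅e 0, e 2⁆ = p₂ • e 1 + q₂ • e 2 := by rw [← h.pr1, l2, k2]; simp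
  rw [b1, b2] at hi
  have hD : p₁ * q₂ - p₂ * q₁ ≠ 0 := by
    intro hD
    obtain ⟨hq2, hq1⟩ := hi q₂ (-q₁) (by
      have : (p₁ * q₂ - p₂ * q₁) • e 1 = 0 := by rw [hD, zero_smul]
      rw [← this]; module)
    obtain ⟨hp2, hp1⟩ := hi p₂ (-p₁) (by
      have : (p₁ * q₂ - p₂ * q₁) • e 2 = 0 := by rw [hD, zero_smul]
      rw [← neg_eq_zero, ← this]; module)
    rw [neg_eq_zero] at hq1 hp1
    exact one_ne_zero (hi 1 0 (by simp [hp1, hq1])).1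
  set D := p₁ * q₂ - p₂ * q₁ with hDdef
  -- Cramer's rule for `x(βy + γz) = xx`, with `x - βy - γz` scaled by the determinant `D` to avoid
  -- division.
  obtain ⟨f, f0, f1, f2⟩ := exists_basis_of_coords hd
    (D • e 0 - (p₀ * q₂ - p₂ * q₀) • e 1 - (p₁ * q₀ - p₀ * q₁) • e 2) (e 1) (e 2)
    (fun a b c hz => by
      obtain ⟨z0, z1, z2⟩ := coords_eq_zero e (a := a * D) (b := b - a * (p₀ * q₂ - p₂ * q₀))
        (c := c - a * (p₁ * q₀ - p₀ * q₁)) (by rw [← hz]; module)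
      have ha := (mul_eq_zero.1 z0).resolve_right hD
      exact ⟨ha, by simpa [ha] using z1, by simpa [ha] using z2⟩)
  have hf : ∀ v, A (f 0) v = D • A (e 0) v := fun v => by rw [f0]; simp [l1, l2]
  have hff : A (f 0) (f 0) = 0 := by
    rw [hf, f0]
    simp only [map_sub, map_smul, k0, k1, k2, hDdef]
    module
  -- Since the new `x` has square zero, skewness makes it orthogonal to its image `xg`, which is the
  -- span of `y` and `z`.
  have hort : ∀ v, B (f 0) (A (e 0) v) = 0 := fun v => by
    have := h.pr2 (f 0) (f 0) v
    rw [hff, hf] at this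
    simpa [hD] using this
  have h1 := hort (e 1)
  have h2' := hort (e 2)
  rw [k1] at h1
  rw [k2] at h2'
  simp only [map_add, map_smul, smul_eq_mul] at h1 h2'
  refine ⟨f, by rw [f1, f2, h12], hff, ?_, ?_⟩
  · have : D * B (f 0) (e 1) = 0 := by linear_combination q₂ * h1 - q₁ * h2'
    rw [f1]
    exact (mul_eq_zero.1 this).resolve_left hD
  · have : D * B (f 0) (e 2) = 0 := by linear_combination p₁ * h2' - p₂ * h1
    rw [f2]
    exact (mul_eq_zero.1 this).resolve_left hD

/-- If `x` is orthogonal to `y` and `z`, then some combination of `y` and `z` is not isotropic. -/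
theorem exists_not_isotropic (h2 : (2 : F) ≠ 0) {B : LinearMap.BilinForm F g} (hs : B.IsSymm)
    (hn : B.Nondegenerate) (e : Module.Basis (Fin 3) F g) (h01 : B (e 0) (e 1) = 0) :
    ∃ m n : F, B (m • e 1 + n • e 2) (m • e 1 + n • e 2) ≠ 0 := by
  -- By polarization the form would vanish on the span of `y` and `z`, putting `y` in the radical.
  by_contra! hiso
  have h11 := hiso 1 0
  have h22 := hiso 0 1
  have h12 := hiso 1 1
  simp only [one_smul, zero_smul, add_zero, zero_add] at h11 h22 h12
  simp only [map_add, LinearMap.add_apply, hs.eq (e 1) (e 2), h11, h22] at h12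
  have h12' : B (e 1) (e 2) = 0 := by
    have : 2 * B (e 1) (e 2) = 0 := by rw [hs.eq (e 2)] at h12; linear_combination h12
    exact (mul_eq_zero.1 this).resolve_left h2
  refine e.ne_zero 1 (hn.1 _ fun w => ?_)
  obtain ⟨a, b, c, rfl⟩ := exists_coords e w
  rw [hs.eq] at h01
  simp [h01, h11, h12']

theorem IsPRProduct.exists_normalForm (h2 : (2 : F) ≠ 0) (hd : Module.finrank F g = 3)
    (hc : LieAlgebra.center F g = ⊥) {B : LinearMap.BilinForm F g} (hs : B.IsSymm)
    (hn : B.Nondegenerate) {A : g →ₗ[F] g →ₗ[F] g} (h : IsPRProduct B A) :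
    ∃ (e : Module.Basis (Fin 3) F g) (a b c : F), a ≠ 0 ∧ b ≠ 0 ∧ c ≠ 0 ∧
      HasStandardBracket e c ∧ HasDiagonalForm e ![a, b, -(b * c)] B := by
  obtain ⟨e, h12, hx, h01, h02⟩ := h.exists_basis_square_zero h2 hd hc hs hn
  have hi := fun s t => lie_independent_of_center_eq_bot hc e h12 (s := s) (t := t)
  obtain ⟨l1, l2, hP⟩ := h.left_mul h2 hs hn e h12 hi
  obtain ⟨m, n, hy⟩ := exists_not_isotropic h2 hs hn e h01
  obtain ⟨p, q, hz⟩ := hP (m • e 1 + n • e 2)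
  have hskew : ∀ v, B (A (e 0) v) v = 0 := fun v => by
    have := h.pr2 (e 0) v v
    rw [hs.eq v] at this
    exact (mul_eq_zero.1 (by linear_combination this : 2 * B (A (e 0) v) v = 0)).resolve_left h2
  have hxy : B (e 0) (m • e 1 + n • e 2) = 0 := by simp [h01, h02]
  have hxz : B (e 0) (p • e 1 + q • e 2) = 0 := by simp [h01, h02]
  have hzy := hskew (m • e 1 + n • e 2)
  rw [hz] at hzy
  have hlie : ⁅e 0, m • e 1 + n • e 2⁆ = p • e 1 + q • e 2 := by
    rw [← h.pr1, hz]; simp [l1, l2]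
  have hz0 : p • e 1 + q • e 2 ≠ 0 := by
    intro h0
    obtain ⟨rfl, rfl⟩ := hi m n (by rw [← h0, ← hlie]; simp)
    simp at hy
  obtain ⟨f, f0, f1, f2⟩ := exists_basis_of_coords hd (e 0) (m • e 1 + n • e 2)
    (p • e 1 + q • e 2) (fun a b c h0 => by
      have ha := (coords_eq_zero e (a := a) (b := b * m + c * p) (c := b * n + c * q)
        (by rw [← h0]; module)).1
      have lin : ∀ y z, B (a • e 0 + b • y + c • z) y = a * B (e 0) y + b * B y y + c * B z y :=
        fun y z => by simp
      have hb := lin (m • e 1 + n • e 2) (p • e 1 + q • e 2)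
      rw [h0, hxy, hzy, map_zero, LinearMap.zero_apply, mul_zero, mul_zero, zero_add, add_zero,
        zero_eq_mul] at hb
      replace hb := hb.resolve_right hy
      rw [ha, hb, zero_smul, zero_smul, zero_add, zero_add] at h0
      exact ⟨ha, hb, (smul_eq_zero.1 h0).resolve_right hz0⟩)
  rw [← f0] at hx hskew
  rw [← f1, ← f0] at hxy
  rw [← f2, ← f0] at hxz
  rw [← f1, ← f2] at hzy
  rw [← f1] at hy
  have hA01 : A (f 0) (f 1) = f 2 := by rw [f0, f1, f2, hz]
  have hA2 : A (f 2) = 0 := by rw [f2]; simp [l1, l2]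
  have h12f : ⁅f 1, f 2⁆ = 0 := by rw [← h.pr1, f1, f2]; simp [l1, l2]
  have hyx := hxy
  have hzx := hxz
  have hyz := hzy
  rw [hs.eq] at hyx hzx hyz
  have hxx0 : B (f 0) (f 0) ≠ 0 := fun h0 => f.ne_zero 0 (hn.1 _ fun w => by
    obtain ⟨a, b, c, rfl⟩ := exists_coords f w
    simp [h0, hxy, hxz])
  have hzz0 : B (f 2) (f 2) ≠ 0 := fun h0 => f.ne_zero 2 (hn.1 _ fun w => by
    obtain ⟨a, b, c, rfl⟩ := exists_coords f w
    simp [h0, hzx, hzy])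
  -- Skewness leaves only the `y`-component of `xz`: pairing with `x` kills `r` because `xx = 0`,
  -- and pairing with `z` kills `s`.
  obtain ⟨r, c, s, hxz'⟩ := exists_coords f (A (f 0) (f 2))
  have hr : r = 0 := by
    have := h.pr2 (f 0) (f 0) (f 2)
    rw [hx, hxz'] at this
    simpa [hxy, hxz, hxx0] using this
  have hs0 : s = 0 := by
    have := hskew (f 2)
    rw [hxz'] at this
    simpa [hxz, hyz, hzz0] using this
  rw [hr, hs0, zero_smul, zero_smul, zero_add, add_zero] at hxz'
  have b01 : ⁅f 0, f 1⁆ = f 2 := by rw [f0, f1, f2, hlie]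
  have b02 : ⁅f 0, f 2⁆ = c • f 1 := by rw [← h.pr1, hA2, hxz']; simp
  have hzz : B (f 2) (f 2) = -(B (f 1) (f 1) * c) := by
    have := h.pr2 (f 0) (f 1) (f 2)
    rw [hA01, hxz', map_smul, smul_eq_mul] at this
    linear_combination this
  have hc0 : c ≠ 0 := by
    rintro rfl
    simp [hzz] at hzz0
  refine ⟨f, B (f 0) (f 0), B (f 1) (f 1), c, hxx0, hy, hc0, ⟨b01, b02, h12f⟩, fun i j => ?_⟩
  fin_cases i <;> fin_cases j <;> simp [hxy, hxz, hyx, hzx, hyz, hzy, hzz]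

end Classification

theorem mainTheorem6 :
    (∀ (F : Type u) [Field F], (2 : F) ≠ 0 →
      ∀ (g : Type v) [LieRing g] [LieAlgebra F g],
        Module.finrank F g = 3 → LieAlgebra.center F g = ⊥ →
        -- a given nondegenerate symmetric form is pseudo-Riemannian iff it has the normal form
        (∀ B : LinearMap.BilinForm F g, B.IsSymm → B.Nondegenerate →
          (IsPseudoRiemannianLie B ↔
            ∃ (e : Module.Basis (Fin 3) F g) (a b c : F), a ≠ 0 ∧ b ≠ 0 ∧ c ≠ 0 ∧
              HasStandardBracket e c ∧ HasDiagonalForm e ![a, b, -(b * c)] B)) ∧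
        -- such a form exists iff the brackets have the normal form
        ((∃ B : LinearMap.BilinForm F g, IsPseudoRiemannianLie B) ↔
          ∃ (e : Module.Basis (Fin 3) F g) (c : F), c ≠ 0 ∧ HasStandardBracket e c) ∧
        -- in a basis with these brackets, every choice of nonzero `a`, `b` occurs
        (∀ (e : Module.Basis (Fin 3) F g) (c : F), c ≠ 0 → HasStandardBracket e c →
          ∀ a b : F, a ≠ 0 → b ≠ 0 →
            ∃! B : LinearMap.BilinForm F g,
              HasDiagonalForm e ![a, b, -(b * c)] B ∧ IsPseudoRiemannianLie B) ∧
        -- the product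
        (∀ (e : Module.Basis (Fin 3) F g) (a b c : F) (B : LinearMap.BilinForm F g),
          a ≠ 0 → b ≠ 0 → c ≠ 0 → HasStandardBracket e c →
          HasDiagonalForm e ![a, b, -(b * c)] B →
            ∀ A : g →ₗ[F] g →ₗ[F] g, IsPRProduct B A ↔ HasStandardProduct e A)) ∧
    -- the real case
    (∀ (g : Type v) [LieRing g] [LieAlgebra ℝ g]
      (e : Module.Basis (Fin 3) ℝ g) (a b c : ℝ) (B : LinearMap.BilinForm ℝ g),
      HasStandardBracket e c → c < 0 → 0 < a → 0 < b →
      HasDiagonalForm e ![a, b, -(b * c)] B →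
        IsRiemannLie B ∧
        ∃ (f : Module.Basis (Fin 3) ℝ g) (t : ℝ), t ≠ 0 ∧ HasDiagonalForm f ![1, 1, 1] B ∧
          ⁅f 0, f 1⁆ = t • f 2 ∧ ⁅f 0, f 2⁆ = -(t • f 1) ∧ ⁅f 1, f 2⁆ = 0 ∧
          ∀ A : g →ₗ[ℝ] g →ₗ[ℝ] g, IsPRProduct B A → HasStandardProduct f A) := by
  refine ⟨fun F _ h2 g _ _ hd hcen => ?_, fun g _ _ e a b c B h hc ha hb hB =>
    ⟨h.isRiemannLie hc ha hb hB, h.exists_orthonormal hc ha hb hB⟩⟩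
  have normal : ∀ B : LinearMap.BilinForm F g, IsPseudoRiemannianLie B →
      ∃ (e : Module.Basis (Fin 3) F g) (a b c : F), a ≠ 0 ∧ b ≠ 0 ∧ c ≠ 0 ∧
        HasStandardBracket e c ∧ HasDiagonalForm e ![a, b, -(b * c)] B := fun B hB => by
    obtain ⟨A, hA⟩ := hB.exists_product
    exact hA.exists_normalForm h2 hd hcen hB.symm hB.nondegenerate
  refine ⟨fun B _ _ => ⟨normal B, ?_⟩, ⟨?_, ?_⟩, fun e c hc he a b ha hb => ?_,
    fun e a b c B ha hb hc he hB => he.isPRProduct_iff h2 ha hb hc hB⟩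
  · rintro ⟨e, a, b, c, ha, hb, hc, he, hB⟩
    exact he.isPseudoRiemannianLie ha hb hc hB
  · rintro ⟨B, hB⟩
    obtain ⟨e, a, b, c, -, -, hc, he, -⟩ := normal B hB
    exact ⟨e, c, hc, he⟩
  · rintro ⟨e, c, hc, he⟩
    obtain ⟨B, hB, -⟩ := existsUnique_hasDiagonalForm e ![1, 1, -(1 * c)]
    exact ⟨B, he.isPseudoRiemannianLie one_ne_zero one_ne_zero hc hB⟩
  · obtain ⟨B, hB, huniq⟩ := existsUnique_hasDiagonalForm e ![a, b, -(b * c)]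
    exact ⟨B, ⟨hB, he.isPseudoRiemannianLie ha hb hc hB⟩, fun B' hB' => huniq B' hB'.1⟩
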